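/- For integers $k \ge 2$ and $l \ge 1$, let $r_k(l,l,l)$ denote the least $n$ such that every colouring of the $k$-element subsets of an $n$-element set with three colours admits an $l$-element subset all of whose $k$-element subsets have the same colour. For every $k \ge 3$ there are a constant $c > 0$ and an integer $l_0$, both depending only on $k$, such that for all $l \ge l_0$ \[ r_k(l,l,l) \;\ge\; 2^{2^{\cdot^{\cdot^{\cdot^{2^{\,l^{\,c\log\log l}}}}}}}, \] where $\log$ is the logarithm to base $2$ and the exponential tower on the right has height $k$, that is, it consists of exactly $k-2$ twos followed by the two top levels $l$ and $c\log\log l$. (So for $k=3$ the bound is $2^{l^{c\log\log l}}$, and for $k=4$ it is $2^{2^{l^{c\log\log l}}}$.) -/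

import Mathlib

/-- `MonoClique χ i S`: for the colouring `χ` of the edges of the complete `k`-uniform hypergraph
on `V` (the `k`-element subsets of `V`), all edges contained in `S` have colour `i`. -/
def MonoClique {V ι : Type*} {k : ℕ} (χ : {e : Finset V // e.card = k} → ι) (i : ι)
    (S : Finset V) : Prop :=
  ∀ e : {e : Finset V // e.card = k}, e.1 ⊆ S → χ e = i

/-- Every colouring of the edges of the complete `k`-uniform hypergraph on `n` vertices with `q`
colours has, for some colour `i`, a complete subhypergraph on `l i` vertices of colour `i`. -/
def RamseyProperty (k : ℕ) {q : ℕ} (l : Fin q → ℕ) (n : ℕ) : Prop :=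
  ∀ χ : {e : Finset (Fin n) // e.card = k} → Fin q,
    ∃ (i : Fin q) (S : Finset (Fin n)), S.card = l i ∧ MonoClique χ i S

/-- The hypergraph Ramsey number `r_k(l_1, …, l_q)`: the least `n` with the Ramsey property. -/
noncomputable def ramseyNumber (k : ℕ) {q : ℕ} (l : Fin q → ℕ) : ℕ :=
  sInf {n : ℕ | RamseyProperty k l n}

/-- `expTower m x` is `2 ^ (2 ^ (⋯ ^ (2 ^ x)))` with exactly `m` twos. -/
noncomputable def expTower : ℕ → ℝ → ℝ
  | 0, x => x
  | m + 1, x => (2 : ℝ) ^ expTower m x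

open Finset

/-! The proof is stepping up in the style of Erdős and Hajnal. Numbers below `2 ^ N` are read as
binary strings, and a set of them is studied through its levels, the top digits where two of its
elements differ.

For triples, a very unbalanced random graph is placed on the levels. A triple has two levels: an
edge gives colour 2, and otherwise the order of the levels decides between 0 and 1. A set of colour
0 or 1 has monotone levels forming an independent set of nearly the same size; `2 ^ s` vertices of
colour 2 force a clique on `s` levels. So cliques need only be excluded at size logarithmic in `l`,
and a graph on `2 ^ a ^ 2` vertices suffices for `l = 2 ^ (4 * a)` (`avoidsMono_three_of_graph`,
`avoidsMono_three`).

For larger uniformity, `AvoidsMono.step` gains one exponential and at most about doubles `l`, with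
no new colour. The resulting top of the tower is `l ^ (c * log l)`, more than the theorem asks. -/

/-! ### Finite Ramsey theorem for hypergraphs -/

/-- The finite Ramsey theorem for `k`-uniform hypergraphs and finitely many colours, for
subsets of `ℕ`. -/
theorem exists_ramsey_bound {q : ℕ} (k : ℕ) (l : Fin q → ℕ) :
    ∃ n : ℕ, ∀ (χ : Finset ℕ → Fin q) (S : Finset ℕ), n ≤ #S →
      ∃ i, ∃ T ⊆ S, #T = l i ∧ ∀ e ⊆ T, #e = k → χ e = i := by
  induction k generalizing l with
  | zero =>
    refine ⟨∑ i, l i, fun χ S hS => ⟨χ ∅, ?_⟩⟩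
    obtain ⟨T, hTS, hT⟩ := exists_subset_card_eq
      ((single_le_sum (f := l) (fun _ _ => Nat.zero_le _) (mem_univ (χ ∅))).trans hS)
    refine ⟨T, hTS, hT, fun e _ he => ?_⟩
    rw [card_eq_zero.1 he]
  | succ k ihk =>
    induction hs : ∑ i, l i generalizing l with
    | zero =>
      refine ⟨0, fun χ S _ => ⟨χ ∅, ∅, empty_subset _, ?_, ?_⟩⟩
      · have := single_le_sum (f := l) (fun _ _ => Nat.zero_le _) (mem_univ (χ ∅))
        simp only [card_empty]
        omega
      · intro e he hc
        rw [subset_empty.1 he] at hc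
        simp at hc
    | succ s ihs =>
      by_cases h0 : ∃ i, l i = 0
      · obtain ⟨i, hi⟩ := h0
        refine ⟨0, fun χ S _ => ⟨i, ∅, empty_subset _, by simp [hi], ?_⟩⟩
        intro e he hc
        rw [subset_empty.1 he] at hc
        simp at hc
      · push Not at h0
        have hdec : ∀ i, ∑ j, Function.update l i (l i - 1) j = s := by
          intro i
          have h1 := sum_update_of_mem (mem_univ i) l (l i - 1)
          have h2 := sum_erase_add univ l (mem_univ i)
          have h3 : univ \ {i} = univ.erase i := by ext; simp
          have := h0 i
          rw [h1, h3]
          omega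
        -- Colour the link of a vertex `x`. Inside a set whose link has colour `i`, a set of size `l
        -- i - 1` in colour `i` is completed by `x`; any other colour already has its full size.
        choose n hn using fun i => ihs (Function.update l i (l i - 1)) (hdec i)
        obtain ⟨M, hM⟩ := ihk n
        refine ⟨M + 1, fun χ S hS => ?_⟩
        obtain ⟨x, hx⟩ : S.Nonempty := card_pos.1 (by omega)
        obtain ⟨i, T, hTS, hT, hTi⟩ := hM (fun e => χ (insert x e)) (S.erase x)
          (by rw [card_erase_of_mem hx]; omega)
        obtain ⟨j, U, hUT, hU, hUj⟩ := hn i χ T hT.ge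
        have hxU : x ∉ U := fun h => notMem_erase x S (hTS (hUT h))
        have hUS : U ⊆ S := (hUT.trans hTS).trans (erase_subset _ _)
        by_cases hij : j = i
        · subst hij
          refine ⟨j, insert x U, insert_subset hx hUS, ?_, ?_⟩
          · have := h0 j
            rw [card_insert_of_notMem hxU, hU, Function.update_self]
            omega
          · intro e he hc
            by_cases hxe : x ∈ e
            · rw [← insert_erase hxe]
              refine hTi _ ((subset_insert_iff.1 he).trans hUT) ?_
              rw [card_erase_of_mem hxe, hc, Nat.add_sub_cancel]
            · exact hUj e ((subset_insert_iff_of_notMem hxe).1 he) hc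
        · exact ⟨j, U, hUS, by rw [hU, Function.update_of_ne hij], hUj⟩

/-- Some number of vertices has the Ramsey property. -/
theorem exists_ramseyProperty (k : ℕ) {q : ℕ} [NeZero q] (l : Fin q → ℕ) :
    ∃ n, RamseyProperty k l n := by
  classical
  obtain ⟨n, hn⟩ := exists_ramsey_bound k l
  refine ⟨n, fun χ => ?_⟩
  let pull : Finset ℕ → Finset (Fin n) := fun e => univ.filter (fun x => (x : ℕ) ∈ e)
  have hpull : ∀ e : Finset (Fin n), pull (e.map Fin.valEmbedding) = e := by
    intro e
    ext x
    simp [pull, Fin.val_inj]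
  obtain ⟨i, T, hTS, hT, hmono⟩ :=
    hn (fun e => if h : #(pull e) = k then χ ⟨pull e, h⟩ else 0) (range n) (by simp)
  have hmap : (pull T).map Fin.valEmbedding = T := by
    ext x
    simp only [pull, mem_map, mem_filter, mem_univ, true_and, Fin.valEmbedding_apply]
    constructor
    · rintro ⟨a, ha, rfl⟩
      exact ha
    · intro hx
      exact ⟨⟨x, mem_range.1 (hTS hx)⟩, hx, rfl⟩
  refine ⟨i, pull T, ?_, ?_⟩
  · rw [← hT, ← hmap, card_map, hmap]
  · rintro ⟨e, he⟩ heT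
    have h := hmono (e.map Fin.valEmbedding) (hmap ▸ map_subset_map.2 heT) (by simpa using he)
    simp only [hpull, he, dif_pos] at h
    exact h

/-! ### Colourings without large monochromatic sets -/

/-- There is a three-colouring of the `k`-element subsets of `{0, …, N - 1}` without a
monochromatic set of `l` or more elements. -/
def AvoidsMono (k l N : ℕ) : Prop :=
  ∃ χ : Finset ℕ → Fin 3, ∀ S ⊆ range N, l ≤ #S → ∀ i, ∃ e ⊆ S, #e = k ∧ χ e ≠ i

theorem AvoidsMono.mono {k l l' N : ℕ} (h : AvoidsMono k l N) (hl : l ≤ l') :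
    AvoidsMono k l' N := by
  obtain ⟨χ, hχ⟩ := h
  exact ⟨χ, fun S hS hc => hχ S hS (hl.trans hc)⟩

theorem AvoidsMono.not_ramseyProperty {k l N n : ℕ} (h : AvoidsMono k l N) (hn : n ≤ N) :
    ¬ RamseyProperty k ![l, l, l] n := by
  classical
  obtain ⟨χ, hχ⟩ := h
  intro hR
  obtain ⟨i, S, hS, hmono⟩ := hR (fun e => χ (e.1.map Fin.valEmbedding))
  have hc : #S = l := by
    rw [hS]
    fin_cases i <;> rfl
  obtain ⟨e, he, hek, hei⟩ := hχ (S.map Fin.valEmbedding) (by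
    intro x hx
    obtain ⟨y, -, rfl⟩ := mem_map.1 hx
    exact mem_range.2 (y.2.trans_le hn)) (by simp [hc]) i
  obtain ⟨u, hu, rfl⟩ := subset_map_iff.1 he
  exact hei (hmono ⟨u, by simpa using hek⟩ hu)

/-- Ramsey's theorem is needed here: `sInf ∅ = 0`, so the bound would fail if no `n` had the
property. -/
theorem AvoidsMono.le_ramseyNumber {k l N : ℕ} (h : AvoidsMono k l N) :
    N ≤ ramseyNumber k ![l, l, l] := by
  by_contra hlt
  exact h.not_ramseyProperty (not_le.1 hlt).le
    (Nat.sInf_mem (s := {n | RamseyProperty k ![l, l, l] n}) (exists_ramseyProperty k _))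

/-! ### The level at which two binary expansions split -/

/-- The position of the most significant binary digit in which `a` and `b` differ. -/
noncomputable def splitLevel (a b : ℕ) : ℕ := sInf {j | a / 2 ^ (j + 1) = b / 2 ^ (j + 1)}

/-- Agreement of binary prefixes persists when more low digits are dropped. -/
theorem splitLevel_le_iff {a b j : ℕ} :
    splitLevel a b ≤ j ↔ a / 2 ^ (j + 1) = b / 2 ^ (j + 1) := by
  constructor
  · intro h
    have hne : {j | a / 2 ^ (j + 1) = b / 2 ^ (j + 1)}.Nonempty := by
      refine ⟨max a b, ?_⟩
      have h2 : max a b < 2 ^ (max a b + 1) :=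
        (Nat.lt_succ_self _).trans Nat.lt_two_pow_self
      rw [Set.mem_ofPred_eq, Nat.div_eq_of_lt ((le_max_left a b).trans_lt h2),
        Nat.div_eq_of_lt ((le_max_right a b).trans_lt h2)]
    have hmem := Nat.sInf_mem hne
    obtain ⟨d, rfl⟩ := Nat.exists_eq_add_of_le h
    have : splitLevel a b + d + 1 = (splitLevel a b + 1) + d := by ring
    rw [this, pow_add, ← Nat.div_div_eq_div_mul, ← Nat.div_div_eq_div_mul]
    exact congrArg (· / 2 ^ d) hmem
  · exact fun h => Nat.sInf_le h

theorem splitLevel_lt {a b N : ℕ} (hab : a < b) (hb : b < 2 ^ N) : splitLevel a b < N := by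
  cases N with
  | zero => omega
  | succ N =>
    rw [Nat.lt_succ_iff, splitLevel_le_iff, Nat.div_eq_of_lt hb, Nat.div_eq_of_lt (hab.trans hb)]

/-- Prefixes are monotone in the number, so those of `a` and `c` agree exactly when that of `b`
agrees with both. -/
theorem splitLevel_eq_max {a b c : ℕ} (hab : a < b) (hbc : b < c) :
    splitLevel a c = max (splitLevel a b) (splitLevel b c) := by
  refine eq_of_forall_ge_iff fun j => ?_
  rw [max_le_iff, splitLevel_le_iff, splitLevel_le_iff, splitLevel_le_iff]
  have h1 : a / 2 ^ (j + 1) ≤ b / 2 ^ (j + 1) := Nat.div_le_div_right hab.le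
  have h2 : b / 2 ^ (j + 1) ≤ c / 2 ^ (j + 1) := Nat.div_le_div_right hbc.le
  omega

theorem div_splitLevel_lt {a b : ℕ} (hab : a < b) :
    a / 2 ^ splitLevel a b < b / 2 ^ splitLevel a b := by
  refine lt_of_le_of_ne (Nat.div_le_div_right hab.le) fun h => ?_
  cases hj : splitLevel a b with
  | zero =>
    rw [hj] at h
    simp at h
    omega
  | succ j =>
    rw [hj] at h
    have := splitLevel_le_iff.2 h
    omega

/-- A digit cannot rise from 0 to 1 twice under the same prefix. -/
theorem splitLevel_ne {a b c : ℕ} (hab : a < b) (hbc : b < c) :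
    splitLevel a b ≠ splitLevel b c := by
  intro h
  have h1 := div_splitLevel_lt hab
  have h2 := div_splitLevel_lt hbc
  have h3 := splitLevel_le_iff.1 (le_refl (splitLevel a b))
  have h4 := splitLevel_le_iff.1 (le_refl (splitLevel b c))
  rw [← h] at h2 h4
  rw [pow_succ, ← Nat.div_div_eq_div_mul, ← Nat.div_div_eq_div_mul] at h3 h4
  omega

/-- A set with at least two elements splits at its top level into a lower and an upper part. -/
theorem exists_top_split {S : Finset ℕ} (hS : 2 ≤ #S) :
    ∃ (D : ℕ) (L R : Finset ℕ), L ∪ R = S ∧ #L + #R = #S ∧ L.Nonempty ∧ R.Nonempty ∧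
      (∀ x ∈ L, ∀ y ∈ R, x < y ∧ splitLevel x y = D) ∧
      (∀ x ∈ L, ∀ y ∈ L, x < y → splitLevel x y < D) ∧
      (∀ x ∈ R, ∀ y ∈ R, x < y → splitLevel x y < D) := by
  classical
  have hne : S.Nonempty := card_pos.1 (by omega)
  set m := S.min' hne with hm
  have hmS : m ∈ S := S.min'_mem hne
  have hmle : ∀ x ∈ S, x ≠ m → m < x := fun x hx hxm =>
    lt_of_le_of_ne (S.min'_le x hx) (Ne.symm hxm)
  have hne' : (S.erase m).Nonempty := card_pos.1 (by rw [card_erase_of_mem hmS]; omega)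
  obtain ⟨z, hz, hmax⟩ := exists_max_image (S.erase m) (splitLevel m) hne'
  set D := splitLevel m z with hD
  have hzm := hmle z (mem_of_mem_erase hz) (ne_of_mem_erase hz)
  have hle : ∀ x ∈ S, ∀ y ∈ S, x < y → splitLevel x y ≤ D := by
    intro x hx y hy hxy
    by_cases hxm : x = m
    · rw [hxm]
      exact hmax y (mem_erase.2 ⟨by omega, hy⟩)
    · have h1 := hmle x hx hxm
      have h2 := hmax y (mem_erase.2 ⟨by omega, hy⟩)
      rw [splitLevel_eq_max h1 hxy] at h2
      exact (le_max_right _ _).trans h2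
  -- The elements sharing digit `D` with the minimum. The case `x = m` is separate because
  -- `splitLevel m m = 0` is not below `D` when `D = 0`.
  let p : ℕ → Prop := fun x => x = m ∨ splitLevel m x < D
  refine ⟨D, S.filter p, S.filter (fun x => ¬ p x), filter_union_filter_not_eq _ _,
    card_filter_add_card_filter_not _, ⟨m, mem_filter.2 ⟨hmS, Or.inl rfl⟩⟩,
    ⟨z, mem_filter.2 ⟨mem_of_mem_erase hz, ?_⟩⟩, ?_, ?_, ?_⟩
  · rintro (h | h) <;> omega
  · intro x hx y hy
    obtain ⟨hxS, hx⟩ := mem_filter.1 hx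
    obtain ⟨hyS, hy⟩ := mem_filter.1 hy
    simp only [p, not_or, not_lt] at hx hy
    have hmy := hmle y hyS hy.1
    have hyD : splitLevel m y = D := le_antisymm (hle m hmS y hyS hmy) hy.2
    rcases eq_or_ne x m with rfl | hxm
    · exact ⟨hmy, hyD⟩
    · have hxD := hx.resolve_left hxm
      have hmx := hmle x hxS hxm
      have hxy : x < y := by
        by_contra hlt
        have hyx : y < x := lt_of_le_of_ne (not_lt.1 hlt) (by rintro rfl; omega)
        have := splitLevel_eq_max hmy hyx
        omega
      have := splitLevel_eq_max hmx hxy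
      exact ⟨hxy, by omega⟩
  · intro x hx y hy hxy
    obtain ⟨hxS, hx⟩ := mem_filter.1 hx
    obtain ⟨hyS, hy⟩ := mem_filter.1 hy
    have hym : y ≠ m := fun h => absurd (S.min'_le x hxS) (by omega)
    have hyD := hy.resolve_left hym
    rcases eq_or_ne x m with rfl | hxm
    · exact hyD
    · have := splitLevel_eq_max (hmle x hxS hxm) hxy
      omega
  · intro x hx y hy hxy
    obtain ⟨hxS, hx⟩ := mem_filter.1 hx
    obtain ⟨hyS, hy⟩ := mem_filter.1 hy
    simp only [p, not_or, not_lt] at hx hy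
    have hmx := hmle x hxS hx.1
    have h1 := splitLevel_ne hmx hxy
    have h2 := hle m hmS x hxS hmx
    have h3 := hle x hxS y hyS hxy
    omega

/-- A set of `2 ^ h` vertices has `h` levels any two of which come from a triple of the set. -/
theorem exists_level_clique (h : ℕ) (S : Finset ℕ) (hS : 2 ^ h ≤ #S) :
    ∃ B : Finset ℕ, #B = h ∧ (∀ D ∈ B, ∃ a ∈ S, ∃ b ∈ S, a < b ∧ splitLevel a b = D) ∧
      ∀ D ∈ B, ∀ D' ∈ B, D' < D → ∃ a ∈ S, ∃ b ∈ S, ∃ c ∈ S, a < b ∧ b < c ∧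
        ((splitLevel a b = D ∧ splitLevel b c = D') ∨
          (splitLevel a b = D' ∧ splitLevel b c = D)) := by
  induction h generalizing S with
  | zero => exact ⟨∅, by simp⟩
  | succ h ih =>
    have h2 : 2 ≤ #S := by
      have := Nat.one_le_two_pow (n := h)
      rw [pow_succ] at hS
      omega
    obtain ⟨D, L, R, hLR, hcard, hLne, hRne, hcross, hL, hR⟩ := exists_top_split h2
    obtain ⟨x₀, hx₀⟩ := hLne
    obtain ⟨y₀, hy₀⟩ := hRne
    have hLS : L ⊆ S := hLR ▸ subset_union_left
    have hRS : R ⊆ S := hLR ▸ subset_union_right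
    -- `H` is the larger half, where the induction runs. The top level `D` joins the levels found
    -- there, and a point of the other half turns a pair of `H` into a triple containing `D`.
    have key : ∀ H ⊆ S, 2 ^ h ≤ #H → (∀ x ∈ H, ∀ y ∈ H, x < y → splitLevel x y < D) →
        (∀ a ∈ H, ∀ b ∈ H, a < b → ∃ a' ∈ S, ∃ b' ∈ S, ∃ c' ∈ S, a' < b' ∧ b' < c' ∧
          ((splitLevel a' b' = D ∧ splitLevel b' c' = splitLevel a b) ∨
          (splitLevel a' b' = splitLevel a b ∧ splitLevel b' c' = D))) →
        ∃ B : Finset ℕ, #B = h + 1 ∧ (∀ D ∈ B, ∃ a ∈ S, ∃ b ∈ S, a < b ∧ splitLevel a b = D) ∧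
      ∀ D ∈ B, ∀ D' ∈ B, D' < D → ∃ a ∈ S, ∃ b ∈ S, ∃ c ∈ S, a < b ∧ b < c ∧
        ((splitLevel a b = D ∧ splitLevel b c = D') ∨
          (splitLevel a b = D' ∧ splitLevel b c = D)) := by
      intro H hHS hH hlt htri
      obtain ⟨B, hB, hB1, hB2⟩ := ih H hH
      have hBlt : ∀ D' ∈ B, D' < D := by
        intro D' hD'
        obtain ⟨a, ha, b, hb, hab, rfl⟩ := hB1 D' hD'
        exact hlt a ha b hb hab
      refine ⟨insert D B, ?_, ?_, ?_⟩
      · rw [card_insert_of_notMem fun h => lt_irrefl _ (hBlt D h), hB]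
      · intro E hE
        rcases mem_insert.1 hE with rfl | hE
        · exact ⟨x₀, hLS hx₀, y₀, hRS hy₀, hcross x₀ hx₀ y₀ hy₀⟩
        · obtain ⟨a, ha, b, hb, h⟩ := hB1 E hE
          exact ⟨a, hHS ha, b, hHS hb, h⟩
      · intro E hE E' hE' hlt'
        rcases mem_insert.1 hE with rfl | hEB
        · rcases mem_insert.1 hE' with rfl | hEB'
          · exact absurd hlt' (lt_irrefl _)
          · obtain ⟨a, ha, b, hb, hab, rfl⟩ := hB1 E' hEB'
            exact htri a ha b hb hab
        · rcases mem_insert.1 hE' with rfl | hEB'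
          · exact absurd (hBlt E hEB) (not_lt.2 hlt'.le)
          · obtain ⟨a, ha, b, hb, c, hc, h⟩ := hB2 E hEB E' hEB' hlt'
            exact ⟨a, hHS ha, b, hHS hb, c, hHS hc, h⟩
    have : 2 ^ h ≤ #L ∨ 2 ^ h ≤ #R := by
      rw [pow_succ] at hS
      omega
    rcases this with hh | hh
    · refine key L hLS hh hL fun a ha b hb hab => ?_
      obtain ⟨h1, h2⟩ := hcross b hb y₀ hy₀
      exact ⟨a, hLS ha, b, hLS hb, y₀, hRS hy₀, hab, h1, Or.inr ⟨rfl, h2⟩⟩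
    · refine key R hRS hh hR fun a ha b hb hab => ?_
      obtain ⟨h1, h2⟩ := hcross x₀ hx₀ a ha
      exact ⟨x₀, hLS hx₀, a, hRS ha, b, hRS hb, h1, hab, Or.inl ⟨h2, rfl⟩⟩

/-! ### Sets with monotone levels -/

/-- The levels of consecutive pairs of `S` increase. -/
def LevelsIncrease (S : Finset ℕ) : Prop :=
  ∀ a ∈ S, ∀ b ∈ S, ∀ c ∈ S, a < b → b < c → splitLevel a b < splitLevel b c

/-- The levels of consecutive pairs of `S` decrease. -/
def LevelsDecrease (S : Finset ℕ) : Prop :=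
  ∀ a ∈ S, ∀ b ∈ S, ∀ c ∈ S, a < b → b < c → splitLevel b c < splitLevel a b

open Classical in
/-- The levels at which the elements of `S` split. -/
noncomputable def levels (S : Finset ℕ) : Finset ℕ :=
  (S.offDiag.filter fun x => x.1 < x.2).image fun x => splitLevel x.1 x.2

theorem mem_levels {S : Finset ℕ} {D : ℕ} :
    D ∈ levels S ↔ ∃ a ∈ S, ∃ b ∈ S, a < b ∧ splitLevel a b = D := by
  simp only [levels, mem_image, mem_filter, mem_offDiag, Prod.exists]
  constructor
  · rintro ⟨a, b, ⟨⟨ha, hb, -⟩, hab⟩, h⟩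
    exact ⟨a, ha, b, hb, hab, h⟩
  · rintro ⟨a, ha, b, hb, hab, h⟩
    exact ⟨a, b, ⟨⟨ha, hb, hab.ne⟩, hab⟩, h⟩

theorem levels_subset_range {S : Finset ℕ} {N : ℕ} (hS : S ⊆ range (2 ^ N)) :
    levels S ⊆ range N := by
  intro D hD
  obtain ⟨a, -, b, hb, hab, rfl⟩ := mem_levels.1 hD
  exact mem_range.2 (splitLevel_lt hab (mem_range.1 (hS hb)))

theorem LevelsIncrease.subset {S T : Finset ℕ} (h : LevelsIncrease S) (hT : T ⊆ S) :
    LevelsIncrease T :=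
  fun a ha b hb c hc => h a (hT ha) b (hT hb) c (hT hc)

theorem LevelsDecrease.subset {S T : Finset ℕ} (h : LevelsDecrease S) (hT : T ⊆ S) :
    LevelsDecrease T :=
  fun a ha b hb c hc => h a (hT ha) b (hT hb) c (hT hc)

/-- If an injective `f` on `S.erase x` enumerates the levels of every subset of `S` through `x`,
then every set of levels comes from a subset of `S`. -/
theorem exists_levels_of_injOn {S : Finset ℕ} {x : ℕ} (hx : x ∈ S) {f : ℕ → ℕ}
    (hf : Set.InjOn f (S.erase x))
    (hlev : ∀ U ⊆ S.erase x, levels (insert x U) = U.image f) :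
    #(levels S) + 1 = #S ∧ ∀ E ⊆ levels S, ∃ e ⊆ S, #e = #E + 1 ∧ levels e = E := by
  classical
  have hall : levels S = (S.erase x).image f := by
    rw [← hlev _ Subset.rfl, insert_erase hx]
  refine ⟨by rw [hall, card_image_of_injOn hf, card_erase_add_one hx], fun E hE => ?_⟩
  rw [hall] at hE
  obtain ⟨U, hU, rfl⟩ := subset_image_iff.1 hE
  have hU' : U ⊆ S.erase x := by exact_mod_cast hU
  have hxU : x ∉ U := fun h => notMem_erase x S (hU' h)
  refine ⟨insert x U, insert_subset hx (hU'.trans (erase_subset _ _)), ?_, hlev U hU'⟩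
  rw [card_insert_of_notMem hxU, card_image_of_injOn (hf.mono hU)]

/-- Under increasing levels, `x` splits from every smaller element at the same level as from the
minimum, so these levels enumerate all of them. -/
theorem LevelsIncrease.exists_levels {S : Finset ℕ} (h : LevelsIncrease S) (hne : S.Nonempty) :
    #(levels S) + 1 = #S ∧ ∀ E ⊆ levels S, ∃ e ⊆ S, #e = #E + 1 ∧ levels e = E := by
  classical
  set m := S.min' hne with hm
  have hmS : m ∈ S := S.min'_mem hne
  have hmle : ∀ x ∈ S.erase m, m < x := fun x hx =>
    lt_of_le_of_ne (S.min'_le x (mem_of_mem_erase hx)) (ne_of_mem_erase hx).symm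
  have hstep : ∀ x ∈ S.erase m, ∀ y ∈ S.erase m, x < y →
      splitLevel m x < splitLevel x y ∧ splitLevel m y = splitLevel x y := by
    intro x hx y hy hxy
    have h1 := h m hmS x (mem_of_mem_erase hx) y (mem_of_mem_erase hy) (hmle x hx) hxy
    have h2 := splitLevel_eq_max (hmle x hx) hxy
    omega
  refine exists_levels_of_injOn (f := splitLevel m) hmS ?_ ?_
  · intro x hx y hy hxy
    rcases lt_trichotomy x y with hlt | heq | hlt
    · have := hstep x hx y hy hlt
      omega
    · exact heq
    · have := hstep y hy x hx hlt
      omega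
  · intro U hU
    ext D
    rw [mem_levels, mem_image]
    constructor
    · rintro ⟨a, ha, b, hb, hab, rfl⟩
      have hbU : b ∈ U := by
        rcases mem_insert.1 hb with rfl | hb
        · rcases mem_insert.1 ha with rfl | ha
          · omega
          · have := hmle a (hU ha)
            omega
        · exact hb
      rcases mem_insert.1 ha with rfl | ha
      · exact ⟨b, hbU, rfl⟩
      · exact ⟨b, hbU, (hstep a (hU ha) b (hU hbU) hab).2⟩
    · rintro ⟨b, hb, rfl⟩
      exact ⟨m, mem_insert_self _ _, b, mem_insert_of_mem hb, hmle b (hU hb), rfl⟩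

/-- The mirror image: levels are read off from the maximum. -/
theorem LevelsDecrease.exists_levels {S : Finset ℕ} (h : LevelsDecrease S) (hne : S.Nonempty) :
    #(levels S) + 1 = #S ∧ ∀ E ⊆ levels S, ∃ e ⊆ S, #e = #E + 1 ∧ levels e = E := by
  classical
  set m := S.max' hne with hm
  have hmS : m ∈ S := S.max'_mem hne
  have hmle : ∀ x ∈ S.erase m, x < m := fun x hx =>
    lt_of_le_of_ne (S.le_max' x (mem_of_mem_erase hx)) (ne_of_mem_erase hx)
  have hstep : ∀ x ∈ S.erase m, ∀ y ∈ S.erase m, x < y →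
      splitLevel y m < splitLevel x y ∧ splitLevel x m = splitLevel x y := by
    intro x hx y hy hxy
    have h1 := h x (mem_of_mem_erase hx) y (mem_of_mem_erase hy) m hmS hxy (hmle y hy)
    have h2 := splitLevel_eq_max hxy (hmle y hy)
    omega
  refine exists_levels_of_injOn (f := fun x => splitLevel x m) hmS ?_ ?_
  · intro x hx y hy hxy
    dsimp only at hxy
    rcases lt_trichotomy x y with hlt | heq | hlt
    · have := hstep x hx y hy hlt
      omega
    · exact heq
    · have := hstep y hy x hx hlt
      omega
  · intro U hU
    ext D
    rw [mem_levels, mem_image]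
    constructor
    · rintro ⟨a, ha, b, hb, hab, rfl⟩
      have haU : a ∈ U := by
        rcases mem_insert.1 ha with rfl | ha
        · rcases mem_insert.1 hb with rfl | hb
          · omega
          · have := hmle b (hU hb)
            omega
        · exact ha
      rcases mem_insert.1 hb with rfl | hb
      · exact ⟨a, haU, rfl⟩
      · exact ⟨a, haU, (hstep a (hU haU) b (hU hb) hab).2⟩
    · rintro ⟨b, hb, rfl⟩
      exact ⟨b, mem_insert_of_mem hb, m, mem_insert_self _ _, hmle b (hU hb), rfl⟩

/-! ### Stepping up from graphs to triples -/

theorem levels_triple {a b c : ℕ} (hab : a < b) (hbc : b < c) :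
    levels {a, b, c} = {splitLevel a b, splitLevel b c} := by
  have h := splitLevel_eq_max hab hbc
  ext D
  rw [mem_levels]
  simp only [mem_insert, mem_singleton]
  constructor
  · rintro ⟨x, hx, y, hy, hxy, rfl⟩
    rcases hx with rfl | rfl | rfl <;> rcases hy with rfl | rfl | rfl <;> omega
  · rintro (rfl | rfl)
    · exact ⟨a, by simp, b, by simp, hab, rfl⟩
    · exact ⟨b, by simp, c, by simp, hbc, rfl⟩

theorem card_triple {a b c : ℕ} (hab : a < b) (hbc : b < c) : #({a, b, c} : Finset ℕ) = 3 :=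
  card_eq_three.2 ⟨a, b, c, hab.ne, (hab.trans hbc).ne, hbc.ne, rfl⟩

/-- A graph on `m` vertices, given by the set `A` of its edges, without complete subgraphs on `s`
vertices and without independent sets of `t` vertices yields a colouring of triples on `2 ^ m`
vertices. -/
theorem avoidsMono_three_of_graph {m s t l : ℕ} (A : Finset ℕ → Prop)
    (hclique : ∀ B ⊆ range m, s ≤ #B → ∃ E ⊆ B, #E = 2 ∧ ¬ A E)
    (hindep : ∀ B ⊆ range m, t ≤ #B → ∃ E ⊆ B, #E = 2 ∧ A E)
    (hs : 2 ^ s ≤ l) (ht : t + 1 ≤ l) : AvoidsMono 3 l (2 ^ m) := by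
  classical
  refine ⟨fun e => if A (levels e) then 2 else if LevelsIncrease e then 0 else 1,
    fun S hS hl i => ?_⟩
  by_contra hcon
  push Not at hcon
  have hmono : ∀ T : Finset ℕ, T ⊆ S → t ≤ #(levels T) →
      (∀ E ⊆ levels T, ∃ e ⊆ T, #e = #E + 1 ∧ levels e = E) →
      (∀ e ⊆ S, #e = 3 → ¬ A (levels e)) → False := by
    intro T hT hcard hE hA
    obtain ⟨E, hEB, hE2, hAE⟩ := hindep (levels T) (levels_subset_range (hT.trans hS)) hcard
    obtain ⟨e, he, hec, rfl⟩ := hE E hEB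
    exact hA e (he.trans hT) (by omega) hAE
  have hne : S.Nonempty := card_pos.1 (by omega)
  by_cases hi : i = 2
  · subst hi
    obtain ⟨B, hB, hB1, hB2⟩ := exists_level_clique s S (hs.trans hl)
    have hBr : B ⊆ range m := fun D hD =>
      levels_subset_range hS (mem_levels.2 (hB1 D hD))
    obtain ⟨E, hEB, hE2, hAE⟩ := hclique B hBr hB.ge
    obtain ⟨x, y, hxy, rfl⟩ := card_eq_two.1 hE2
    have hx : x ∈ B := hEB (by simp)
    have hy : y ∈ B := hEB (by simp)
    have main : ∃ a ∈ S, ∃ b ∈ S, ∃ c ∈ S, a < b ∧ b < c ∧ levels {a, b, c} = {x, y} := by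
      rcases lt_or_gt_of_ne hxy with hlt | hlt
      · obtain ⟨a, ha, b, hb, c, hc, hab, hbc, h⟩ := hB2 y hy x hx hlt
        refine ⟨a, ha, b, hb, c, hc, hab, hbc, ?_⟩
        rw [levels_triple hab hbc]
        rcases h with ⟨rfl, rfl⟩ | ⟨rfl, rfl⟩
        · exact pair_comm _ _
        · rfl
      · obtain ⟨a, ha, b, hb, c, hc, hab, hbc, h⟩ := hB2 x hx y hy hlt
        refine ⟨a, ha, b, hb, c, hc, hab, hbc, ?_⟩
        rw [levels_triple hab hbc]
        rcases h with ⟨rfl, rfl⟩ | ⟨rfl, rfl⟩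
        · rfl
        · exact pair_comm _ _
    obtain ⟨a, ha, b, hb, c, hc, hab, hbc, hlev⟩ := main
    have h := hcon {a, b, c} (by simp [insert_subset_iff, ha, hb, hc]) (card_triple hab hbc)
    rw [hlev, if_neg hAE] at h
    split_ifs at h <;> simp at h
  · have hA : ∀ e ⊆ S, #e = 3 → ¬ A (levels e) := by
      intro e he hc hA
      have h := hcon e he hc
      rw [if_pos hA] at h
      exact hi h.symm
    by_cases hi0 : i = 0
    · subst hi0
      have hinc : LevelsIncrease S := by
        intro a ha b hb c hc hab hbc
        have hsub : ({a, b, c} : Finset ℕ) ⊆ S := by simp [insert_subset_iff, ha, hb, hc]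
        have h := hcon _ hsub (card_triple hab hbc)
        rw [if_neg (hA _ hsub (card_triple hab hbc))] at h
        split_ifs at h with hI
        · exact hI a (by simp) b (by simp) c (by simp) hab hbc
        · simp at h
      obtain ⟨h1, h2⟩ := hinc.exists_levels hne
      exact hmono S Subset.rfl (by omega) h2 hA
    · have hdec : LevelsDecrease S := by
        intro a ha b hb c hc hab hbc
        have hsub : ({a, b, c} : Finset ℕ) ⊆ S := by simp [insert_subset_iff, ha, hb, hc]
        have h := hcon _ hsub (card_triple hab hbc)
        rw [if_neg (hA _ hsub (card_triple hab hbc))] at h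
        split_ifs at h with hI
        · exact absurd h.symm hi0
        · by_contra hlt
          have hlt' : splitLevel a b < splitLevel b c :=
            lt_of_le_of_ne (not_lt.1 hlt) (splitLevel_ne hab hbc)
          refine hI fun x hx y hy z hz hxy hyz => ?_
          simp only [mem_insert, mem_singleton] at hx hy hz
          have h1 : x = a := by omega
          have h2 : y = b := by omega
          have h3 : z = c := by omega
          rwa [h1, h2, h3]
      obtain ⟨h1, h2⟩ := hdec.exists_levels hne
      exact hmono S Subset.rfl (by omega) h2 hA

/-! ### Stepping up from `k`-sets to `(k + 1)`-sets -/

/-- A set without a local maximum among its levels contains a large set with monotone levels. -/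
theorem exists_monotone_of_no_localMax (p r : ℕ) (S : Finset ℕ) (hS : p + r ≤ #S)
    (hno : ∀ a ∈ S, ∀ b ∈ S, ∀ c ∈ S, ∀ d ∈ S, a < b → b < c → c < d →
      ¬ (splitLevel a b < splitLevel b c ∧ splitLevel c d < splitLevel b c)) :
    ∃ T ⊆ S, (LevelsIncrease T ∧ #T = p) ∨ (LevelsDecrease T ∧ #T = r) := by
  classical
  induction hn : p + r generalizing p r S with
  | zero => exact ⟨∅, empty_subset _, Or.inl ⟨by simp [LevelsIncrease], by simp; omega⟩⟩
  | succ n ih =>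
    rcases Nat.eq_zero_or_pos p with rfl | hp
    · exact ⟨∅, empty_subset _, Or.inl ⟨by simp [LevelsIncrease], by simp⟩⟩
    rcases Nat.eq_zero_or_pos r with rfl | hr
    · exact ⟨∅, empty_subset _, Or.inr ⟨by simp [LevelsDecrease], by simp⟩⟩
    obtain ⟨D, L, R, hLR, hcard, hLne, hRne, hcross, hL, hR⟩ :=
      exists_top_split (S := S) (by omega)
    have hLS : L ⊆ S := hLR ▸ subset_union_left
    have hRS : R ⊆ S := hLR ▸ subset_union_right
    -- Two points on each side of the top split would make `D` a local maximum. The lone point then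
    -- extends a monotone set of the other side by its largest level.
    have hone : #L = 1 ∨ #R = 1 := by
      by_contra hcon
      push Not at hcon
      have hL1 := card_pos.2 hLne
      have hR1 := card_pos.2 hRne
      have pair : ∀ H : Finset ℕ, 1 < #H → ∃ a ∈ H, ∃ b ∈ H, a < b := by
        intro H hH
        obtain ⟨a, ha, b, hb, hab⟩ := one_lt_card.1 hH
        rcases lt_or_gt_of_ne hab with h | h
        · exact ⟨a, ha, b, hb, h⟩
        · exact ⟨b, hb, a, ha, h⟩
      obtain ⟨a, ha, b, hb, hab⟩ := pair L (by omega)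
      obtain ⟨c, hc, d, hd, hcd⟩ := pair R (by omega)
      obtain ⟨hbc, hD⟩ := hcross b hb c hc
      refine hno a (hLS ha) b (hLS hb) c (hRS hc) d (hRS hd) hab hbc hcd ?_
      rw [hD]
      exact ⟨hL a ha b hb hab, hR c hc d hd hcd⟩
    rcases hone with h1 | h1
    · obtain ⟨x, hx⟩ := hLne
      obtain ⟨T, hTR, hT⟩ := ih p (r - 1) R (by omega)
        (fun a ha b hb c hc d hd => hno a (hRS ha) b (hRS hb) c (hRS hc) d (hRS hd)) (by omega)
      rcases hT with ⟨hT, hTc⟩ | ⟨hT, hTc⟩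
      · exact ⟨T, hTR.trans hRS, Or.inl ⟨hT, hTc⟩⟩
      · have hxT : ∀ y ∈ T, x < y := fun y hy => (hcross x hx y (hTR hy)).1
        refine ⟨insert x T, insert_subset (hLS hx) (hTR.trans hRS), Or.inr ⟨?_, ?_⟩⟩
        · intro a ha b hb c hc hab hbc
          have mem : ∀ y ∈ insert x T, x < y → y ∈ T := fun y hy hxy =>
            (mem_insert.1 hy).resolve_left hxy.ne'
          have hxa : x ≤ a := by
            rcases mem_insert.1 ha with rfl | ha
            · exact le_rfl
            · exact (hxT a ha).le
          have hbT := mem b hb (by omega)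
          have hcT := mem c hc (by omega)
          rcases mem_insert.1 ha with rfl | haT
          · rw [(hcross a hx b (hTR hbT)).2]
            exact hR b (hTR hbT) c (hTR hcT) hbc
          · exact hT a haT b hbT c hcT hab hbc
        · rw [card_insert_of_notMem fun h => lt_irrefl _ (hxT x h)]
          omega
    · obtain ⟨x, hx⟩ := hRne
      obtain ⟨T, hTL, hT⟩ := ih (p - 1) r L (by omega)
        (fun a ha b hb c hc d hd => hno a (hLS ha) b (hLS hb) c (hLS hc) d (hLS hd)) (by omega)
      rcases hT with ⟨hT, hTc⟩ | ⟨hT, hTc⟩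
      · have hxT : ∀ y ∈ T, y < x := fun y hy => (hcross y (hTL hy) x hx).1
        refine ⟨insert x T, insert_subset (hRS hx) (hTL.trans hLS), Or.inl ⟨?_, ?_⟩⟩
        · intro a ha b hb c hc hab hbc
          have mem : ∀ y ∈ insert x T, y < x → y ∈ T := fun y hy hxy =>
            (mem_insert.1 hy).resolve_left hxy.ne
          have hxc : c ≤ x := by
            rcases mem_insert.1 hc with rfl | hc
            · exact le_rfl
            · exact (hxT c hc).le
          have hbT := mem b hb (by omega)
          have haT := mem a ha (by omega)
          rcases mem_insert.1 hc with rfl | hcT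
          · rw [(hcross b (hTL hbT) c hx).2]
            exact hL a (hTL haT) b (hTL hbT) hab
          · exact hT a haT b hbT c hcT hab hbc
        · rw [card_insert_of_notMem fun h => lt_irrefl _ (hxT x h)]
          omega
      · exact ⟨T, hTL.trans hLS, Or.inr ⟨hT, hTc⟩⟩

/-- A set without a local minimum among its levels contains a large set with monotone levels. -/
theorem exists_monotone_of_no_localMin (p r : ℕ) (S : Finset ℕ) (hS : p + r ≤ #S) (hp : 1 ≤ p)
    (hr : 1 ≤ r)
    (hno : ∀ a ∈ S, ∀ b ∈ S, ∀ c ∈ S, ∀ d ∈ S, a < b → b < c → c < d →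
      ¬ (splitLevel b c < splitLevel a b ∧ splitLevel b c < splitLevel c d)) :
    ∃ T ⊆ S, (LevelsIncrease T ∧ p ≤ #T) ∨ (LevelsDecrease T ∧ r ≤ #T) := by
  obtain ⟨D, L, R, hLR, hcard, ⟨x, hx⟩, ⟨y, hy⟩, hcross, hL, hR⟩ :=
    exists_top_split (S := S) (by omega)
  have hLS : L ⊆ S := hLR ▸ subset_union_left
  have hRS : R ⊆ S := hLR ▸ subset_union_right
  -- A point of `R` appended to three points of `L` adds the larger level `D`, so a descent inside
  -- `L` would create a local minimum. The same holds for an ascent in `R`, with a point of `L`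
  -- prepended.
  have hinc : LevelsIncrease L := by
    intro a ha b hb c hc hab hbc
    obtain ⟨hcy, hD⟩ := hcross c hc y hy
    have h1 := hno a (hLS ha) b (hLS hb) c (hLS hc) y (hRS hy) hab hbc hcy
    have h2 := hL b hb c hc hbc
    have h3 := splitLevel_ne hab hbc
    omega
  have hdec : LevelsDecrease R := by
    intro a ha b hb c hc hab hbc
    obtain ⟨hxa, hD⟩ := hcross x hx a ha
    have h1 := hno x (hLS hx) a (hRS ha) b (hRS hb) c (hRS hc) hxa hab hbc
    have h2 := hR a ha b hb hab
    have h3 := splitLevel_ne hab hbc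
    omega
  by_cases h : p ≤ #L
  · exact ⟨L, hLS, Or.inl ⟨hinc, h⟩⟩
  · exact ⟨R, hRS, Or.inr ⟨hdec, by omega⟩⟩

theorem exists_upper_segment (r : ℕ) (S : Finset ℕ) (hr : r ≤ #S) :
    ∃ S' ⊆ S, ∃ Z ⊆ S, #Z = r ∧ #S' + r = #S ∧ ∀ x ∈ S', ∀ z ∈ Z, x < z := by
  classical
  induction r generalizing S with
  | zero => exact ⟨S, Subset.rfl, ∅, by simp⟩
  | succ r ih =>
    have hne : S.Nonempty := card_pos.1 (by omega)
    have hM := S.max'_mem hne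
    have hMc := card_erase_add_one hM
    obtain ⟨S', hS', Z, hZ, hZc, hc, hlt⟩ := ih (S.erase (S.max' hne)) (by omega)
    have hMZ : S.max' hne ∉ Z := fun h => notMem_erase _ S (hZ h)
    refine ⟨S', hS'.trans (erase_subset _ _), insert (S.max' hne) Z,
      insert_subset hM (hZ.trans (erase_subset _ _)), ?_, by omega, ?_⟩
    · rw [card_insert_of_notMem hMZ, hZc]
    · intro x hx z hz
      rcases mem_insert.1 hz with rfl | hz
      · exact lt_of_le_of_ne (S.le_max' x (mem_of_mem_erase (hS' hx))) (ne_of_mem_erase (hS' hx))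
      · exact hlt x hx z hz

/-- The levels of the three smallest elements of `e` increase. -/
def StartsIncreasing (e : Finset ℕ) : Prop :=
  ∃ a ∈ e, ∃ b ∈ e, ∃ c ∈ e, a < b ∧ b < c ∧ (∀ x ∈ e, x = a ∨ x = b ∨ c ≤ x) ∧
    splitLevel a b < splitLevel b c

theorem startsIncreasing_iff {e : Finset ℕ} {a b c : ℕ} (ha : a ∈ e) (hb : b ∈ e) (hc : c ∈ e)
    (hab : a < b) (hbc : b < c) (he : ∀ x ∈ e, x = a ∨ x = b ∨ c ≤ x) :
    StartsIncreasing e ↔ splitLevel a b < splitLevel b c := by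
  constructor
  · rintro ⟨a', ha', b', hb', c', hc', hab', hbc', he', h⟩
    have h1 := he a' ha'
    have h2 := he b' hb'
    have h3 := he c' hc'
    have h4 := he' a ha
    have h5 := he' b hb
    have h6 := he' c hc
    obtain rfl : a = a' := by omega
    obtain rfl : b = b' := by omega
    obtain rfl : c = c' := by omega
    exact h
  · exact fun h => ⟨a, ha, b, hb, c, hc, hab, hbc, he, h⟩

/-- The stepping-up lemma. -/
theorem AvoidsMono.step {k l N : ℕ} (hk : 3 ≤ k) (h : AvoidsMono k l N) :
    AvoidsMono (k + 1) (2 * (l + 1) + (k - 3)) (2 ^ N) := by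
  classical
  obtain ⟨χ, hχ⟩ := h
  refine ⟨fun e => if LevelsIncrease e ∨ LevelsDecrease e then χ (levels e) else
    if StartsIncreasing e then 0 else 1, fun S hS hl i => ?_⟩
  by_contra hcon
  push Not at hcon
  -- The top `k - 3` elements are kept as padding: they complete any four points of `S'` to an edge
  -- without changing its three smallest elements.
  obtain ⟨S', hS', Z, hZ, hZc, hcard, hlt⟩ := exists_upper_segment (k - 3) S (by omega)
  have hext : ∀ a ∈ S', ∀ b ∈ S', ∀ c ∈ S', ∀ d ∈ S', a < b → b < c → c < d →
      ∃ e ⊆ S, #e = k + 1 ∧ a ∈ e ∧ b ∈ e ∧ c ∈ e ∧ d ∈ e ∧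
        ∀ x ∈ e, x = a ∨ x = b ∨ c ≤ x := by
    intro a ha b hb c hc d hd hab hbc hcd
    have hdisj : Disjoint ({a, b, c, d} : Finset ℕ) Z := by
      rw [disjoint_left]
      intro x hx hxZ
      simp only [mem_insert, mem_singleton] at hx
      have h1 := hlt d hd x hxZ
      omega
    have h4 : #({a, b, c, d} : Finset ℕ) = 4 := by
      rw [card_insert_of_notMem (by simp only [mem_insert, mem_singleton]; omega),
        card_triple hbc hcd]
    refine ⟨{a, b, c, d} ∪ Z, union_subset ?_ hZ, ?_, by simp, by simp, by simp, by simp, ?_⟩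
    · simp [insert_subset_iff, hS' ha, hS' hb, hS' hc, hS' hd]
    · rw [card_union_of_disjoint hdisj, h4, hZc]
      omega
    · intro x hx
      rcases mem_union.1 hx with hx | hx
      · simp only [mem_insert, mem_singleton] at hx
        omega
      · have := hlt c hc x hx
        omega
  have hmono : ∃ T ⊆ S', (LevelsIncrease T ∧ l + 1 ≤ #T) ∨ (LevelsDecrease T ∧ l + 1 ≤ #T) := by
    -- A local minimum extends to an edge of colour 1 and a local maximum to one of colour 0. Hence
    -- colour 0 excludes minima and every other colour excludes maxima.
    by_cases hi : i = 0
    · subst hi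
      refine exists_monotone_of_no_localMin _ _ S' (by omega) (by omega) (by omega) ?_
      rintro a ha b hb c hc d hd hab hbc hcd ⟨h1, h2⟩
      obtain ⟨e, heS, hec, hae, hbe, hce, hde, he⟩ := hext a ha b hb c hc d hd hab hbc hcd
      have hcol := hcon e heS hec
      rw [if_neg, if_neg] at hcol
      · simp at hcol
      · rw [startsIncreasing_iff hae hbe hce hab hbc he]
        omega
      · rintro (h | h)
        · have := h a hae b hbe c hce hab hbc
          omega
        · have := h b hbe c hce d hde hbc hcd
          omega
    · obtain ⟨T, hT, h⟩ := exists_monotone_of_no_localMax (l + 1) (l + 1) S' (by omega) (by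
        rintro a ha b hb c hc d hd hab hbc hcd ⟨h1, h2⟩
        obtain ⟨e, heS, hec, hae, hbe, hce, hde, he⟩ := hext a ha b hb c hc d hd hab hbc hcd
        have hcol := hcon e heS hec
        rw [if_neg, if_pos] at hcol
        · exact hi hcol.symm
        · rwa [startsIncreasing_iff hae hbe hce hab hbc he]
        · rintro (h | h)
          · have := h b hbe c hce d hde hbc hcd
            omega
          · have := h a hae b hbe c hce hab hbc
            omega)
      exact ⟨T, hT, h.imp (And.imp_right Eq.ge) (And.imp_right Eq.ge)⟩
  obtain ⟨T, hT, hTm⟩ := hmono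
  have hTc : l + 1 ≤ #T := hTm.elim And.right And.right
  have hTne : T.Nonempty := card_pos.1 (by omega)
  have hlev : #(levels T) + 1 = #T ∧ ∀ E ⊆ levels T, ∃ e ⊆ T, #e = #E + 1 ∧ levels e = E :=
    hTm.elim (fun h => h.1.exists_levels hTne) (fun h => h.1.exists_levels hTne)
  obtain ⟨E, hE, hEk, hEi⟩ := hχ (levels T) (levels_subset_range ((hT.trans hS').trans hS))
    (by omega) i
  obtain ⟨e, heT, hec, rfl⟩ := hlev.2 E hE
  have hcol := hcon e ((heT.trans hT).trans hS') (by omega)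
  rw [if_pos (hTm.imp (fun h => h.1.subset heT) (fun h => h.1.subset heT))] at hcol
  exact hEi hcol

/-! ### Unbalanced Ramsey graphs by counting -/

/-- Counting form of independence: a uniform map to `Fin q` sends all of `P` into `A` with
probability `(#A / q) ^ #P`. -/
theorem card_piFinset_constraint {α : Type*} [Fintype α] [DecidableEq α] {q : ℕ} (hq : 0 < q)
    (P : Finset α) (A : Finset (Fin q)) :
    (#(Fintype.piFinset fun x => if x ∈ P then A else univ) : ℝ) =
      (q : ℝ) ^ Fintype.card α * ((#A : ℝ) / q) ^ #P := by
  have hq' : (q : ℝ) ≠ 0 := by positivity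
  rw [Fintype.card_piFinset]
  push_cast
  have h : ∀ x : α, ((#(if x ∈ P then A else univ) : ℕ) : ℝ) =
      q * (if x ∈ P then (#A : ℝ) / q else 1) := by
    intro x
    split_ifs
    · field_simp
    · simp
  rw [prod_congr rfl fun x _ => h x, prod_mul_distrib, Fintype.prod_ite_mem, prod_const, prod_const,
    card_univ]

/-- If the expected number of cliques on `s` vertices and independent sets of `t` vertices in a
random graph with edge probability `1 / q` is less than one, then some graph has neither. -/
theorem exists_unbalanced_ramsey_graph {m s t q : ℕ} (hq : 0 < q)
    (h : (m.choose s : ℝ) * (1 / q) ^ s.choose 2 +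
      (m.choose t : ℝ) * ((q - 1) / q) ^ t.choose 2 < 1) :
    ∃ A : Finset ℕ → Prop, (∀ B ⊆ range m, s ≤ #B → ∃ E ⊆ B, #E = 2 ∧ ¬ A E) ∧
      (∀ B ⊆ range m, t ≤ #B → ∃ E ⊆ B, #E = 2 ∧ A E) := by
  classical
  have : NeZero q := ⟨hq.ne'⟩
  let α := {E : Finset ℕ // E ∈ powersetCard 2 (range m)}
  let pairs : Finset ℕ → Finset α := fun B => univ.filter fun E => E.1 ⊆ B
  have hpairs : ∀ B ⊆ range m, #(pairs B) = (#B).choose 2 := by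
    intro B hB
    rw [← card_powersetCard]
    refine card_bij (fun E _ => E.1) ?_ ?_ ?_
    · intro E hE
      exact mem_powersetCard.2 ⟨(mem_filter.1 hE).2, (mem_powersetCard.1 E.2).2⟩
    · intro E _ E' _ hEE
      exact Subtype.ext hEE
    · intro E hE
      obtain ⟨h1, h2⟩ := mem_powersetCard.1 hE
      exact ⟨⟨E, mem_powersetCard.2 ⟨h1.trans hB, h2⟩⟩, by simp [pairs, h1], rfl⟩
  -- Pairs of value 0 are the edges, so `C = {0}` describes cliques and its complement independent
  -- sets.
  let bad : Finset (Fin q) → Finset ℕ → Finset (α → Fin q) := fun C B =>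
    Fintype.piFinset fun x => if x ∈ pairs B then C else univ
  have hbad : ∀ (C : Finset (Fin q)) (u : ℕ),
      (#((powersetCard u (range m)).biUnion (bad C)) : ℝ) ≤
        (q : ℝ) ^ Fintype.card α * ((m.choose u : ℝ) * ((#C : ℝ) / q) ^ u.choose 2) := by
    intro C u
    calc (#((powersetCard u (range m)).biUnion (bad C)) : ℝ)
        ≤ ∑ B ∈ powersetCard u (range m), (#(bad C B) : ℝ) := by
          exact_mod_cast card_biUnion_le
      _ = ∑ B ∈ powersetCard u (range m),
            (q : ℝ) ^ Fintype.card α * ((#C : ℝ) / q) ^ u.choose 2 := by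
          refine sum_congr rfl fun B hB => ?_
          obtain ⟨h1, h2⟩ := mem_powersetCard.1 hB
          rw [card_piFinset_constraint hq, hpairs B h1, h2]
      _ = _ := by
          rw [sum_const, card_powersetCard, card_range, nsmul_eq_mul]
          ring
  have hC0 : #({0} : Finset (Fin q)) = 1 := card_singleton _
  have hC1 : ((#(univ.erase (0 : Fin q)) : ℕ) : ℝ) = q - 1 := by
    rw [card_erase_of_mem (mem_univ _), card_univ, Fintype.card_fin, Nat.cast_sub hq, Nat.cast_one]
  have hex : ∃ f : α → Fin q, f ∉ (powersetCard s (range m)).biUnion (bad {0}) ∪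
      (powersetCard t (range m)).biUnion (bad (univ.erase 0)) := by
    by_contra hcon
    push Not at hcon
    have huniv := eq_univ_iff_forall.2 hcon
    have hle := card_union_le ((powersetCard s (range m)).biUnion (bad {0}))
      ((powersetCard t (range m)).biUnion (bad (univ.erase 0)))
    rw [huniv, card_univ, Fintype.card_fun, Fintype.card_fin] at hle
    have hle' := Nat.cast_le (α := ℝ).2 hle
    push_cast at hle'
    have h1 := hbad {0} s
    have h2 := hbad (univ.erase 0) t
    rw [hC0, Nat.cast_one] at h1
    rw [hC1] at h2
    have hpos : (0 : ℝ) < (q : ℝ) ^ Fintype.card α := by positivity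
    have := mul_lt_mul_of_pos_left h hpos
    linarith
  obtain ⟨f, hf⟩ := hex
  simp only [mem_union, mem_biUnion, not_or, not_exists, not_and] at hf
  have find : ∀ (C : Finset (Fin q)) (u : ℕ),
      (∀ B ∈ powersetCard u (range m), f ∉ bad C B) → ∀ B ⊆ range m, u ≤ #B →
        ∃ x : α, x.1 ⊆ B ∧ f x ∉ C := by
    intro C u hfu B hB hu
    obtain ⟨B', hB', hB'c⟩ := exists_subset_card_eq hu
    have hnot := hfu B' (mem_powersetCard.2 ⟨hB'.trans hB, hB'c⟩)
    simp only [bad, Fintype.mem_piFinset, not_forall] at hnot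
    obtain ⟨x, hx⟩ := hnot
    by_cases hxP : x ∈ pairs B'
    · rw [if_pos hxP] at hx
      exact ⟨x, (mem_filter.1 hxP).2.trans hB', hx⟩
    · rw [if_neg hxP] at hx
      exact absurd (mem_univ _) hx
  refine ⟨fun E => ∃ hE : E ∈ powersetCard 2 (range m), f ⟨E, hE⟩ = 0, fun B hB hs => ?_,
    fun B hB ht => ?_⟩
  · obtain ⟨x, hxB, hx⟩ := find {0} s hf.1 B hB hs
    refine ⟨x.1, hxB, (mem_powersetCard.1 x.2).2, ?_⟩
    rintro ⟨_, h0⟩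
    exact hx (mem_singleton.2 h0)
  · obtain ⟨x, hxB, hx⟩ := find (univ.erase 0) t hf.2 B hB ht
    exact ⟨x.1, hxB, (mem_powersetCard.1 x.2).2, x.2, by simpa using hx⟩

theorem sq_add_four_le_two_pow {a : ℕ} (ha : 8 ≤ a) : 2 * a ^ 2 + 4 ≤ 2 ^ a := by
  induction a, ha using Nat.le_induction with
  | base => norm_num
  | succ a ha ih =>
    rw [pow_succ 2]
    nlinarith

/-- Edge probability `2 ^ (-2a)`, with cliques of size `4 * a` and independent sets of size `2 ^ (3
* a) + 1` excluded; each expected number is at most `1 / 4`. -/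
theorem avoidsMono_three {a : ℕ} (ha : 8 ≤ a) : AvoidsMono 3 (2 ^ (4 * a)) (2 ^ 2 ^ a ^ 2) := by
  have hsq := sq_add_four_le_two_pow ha
  set Y := 2 ^ (3 * a) with hY
  have hY1 : 1 ≤ Y := Nat.one_le_two_pow
  have h1 : ((2 ^ a ^ 2).choose (4 * a) : ℝ) * (1 / (2 ^ (2 * a) : ℕ)) ^ (4 * a).choose 2 ≤
      1 / 4 := by
    have hch : (4 * a).choose 2 = 2 * a * (4 * a - 1) := by
      rw [Nat.choose_two_right, show 4 * a * (4 * a - 1) = 2 * (2 * a * (4 * a - 1)) by ring]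
      simp
    have hle : ((2 ^ a ^ 2).choose (4 * a) : ℝ) ≤ 2 ^ (a ^ 2 * (4 * a)) := by
      rw [pow_mul]
      exact_mod_cast Nat.choose_le_pow _ _
    have hexp : a ^ 2 * (4 * a) + 2 ≤ 2 * a * (2 * a * (4 * a - 1)) := by
      obtain ⟨b, rfl⟩ := Nat.exists_eq_add_of_le ha
      rw [show 4 * (8 + b) - 1 = 4 * b + 31 by omega]
      nlinarith [sq_nonneg b, Nat.zero_le (b ^ 3)]
    have hpow : (2 : ℝ) ^ (a ^ 2 * (4 * a)) * 4 ≤ 2 ^ (2 * a * (2 * a * (4 * a - 1))) := by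
      rw [show (4 : ℝ) = 2 ^ 2 by norm_num, ← pow_add]
      exact pow_le_pow_right₀ (by norm_num) hexp
    rw [hch]
    push_cast
    rw [one_div, inv_pow, ← pow_mul, ← div_eq_mul_inv, div_le_iff₀ (by positivity)]
    linarith
  have h2 : ((2 ^ a ^ 2).choose (Y + 1) : ℝ) *
      (((2 ^ (2 * a) : ℕ) - 1 : ℝ) / (2 ^ (2 * a) : ℕ)) ^ (Y + 1).choose 2 ≤ 1 / 4 := by
    set q := 2 ^ (2 * a) with hq
    have hq1 : 1 ≤ q := Nat.one_le_two_pow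
    have hq1' : (1 : ℝ) ≤ q := by exact_mod_cast hq1
    have hle : ((2 ^ a ^ 2).choose (Y + 1) : ℝ) ≤ 2 ^ (a ^ 2 * (Y + 1)) := by
      rw [pow_mul]
      exact_mod_cast Nat.choose_le_pow _ _
    have hx0 : (0 : ℝ) ≤ ((q : ℝ) - 1) / q := div_nonneg (by linarith) (by linarith)
    have hx1 : ((q : ℝ) - 1) / q ≤ 1 := by
      rw [div_le_one (by linarith)]
      linarith
    have hhalf : (((q : ℝ) - 1) / q) ^ q ≤ 1 / 2 := by
      have := Real.one_sub_div_pow_le_exp_neg (n := q) (t := 1) hq1'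
      have h3 := Real.exp_neg_one_lt_d9
      rw [show ((q : ℝ) - 1) / q = 1 - 1 / q by field_simp]
      linarith
    -- Each block of `q` non-edges costs a factor of at most `1 / 2`; there are enough blocks to
    -- cancel the binomial bound with a factor `1 / 4` left.
    have hexp : q * (a ^ 2 * (Y + 1) + 2) ≤ (Y + 1).choose 2 := by
      rw [Nat.choose_two_right, Nat.le_div_iff_mul_le (by norm_num), Nat.add_sub_cancel]
      have hqY : Y = q * 2 ^ a := by
        rw [hY, hq, ← pow_add]
        ring_nf
      calc q * (a ^ 2 * (Y + 1) + 2) * 2 ≤ q * ((Y + 1) * (2 * a ^ 2 + 4)) := by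
            nlinarith [Nat.zero_le (q * Y)]
        _ ≤ q * ((Y + 1) * 2 ^ a) := by gcongr
        _ = (Y + 1) * Y := by
            nth_rewrite 3 [hqY]
            ring
    calc _ ≤ (2 : ℝ) ^ (a ^ 2 * (Y + 1)) * (((q : ℝ) - 1) / q) ^ (q * (a ^ 2 * (Y + 1) + 2)) := by
          gcongr ?_ * ?_
          exact pow_le_pow_of_le_one hx0 hx1 hexp
      _ ≤ (2 : ℝ) ^ (a ^ 2 * (Y + 1)) * (1 / 2) ^ (a ^ 2 * (Y + 1) + 2) := by
          rw [pow_mul (((q : ℝ) - 1) / q)]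
          gcongr
      _ = 1 / 4 := by
          rw [pow_add (1 / 2 : ℝ), ← mul_assoc, ← mul_pow]
          norm_num
  obtain ⟨A, hA1, hA2⟩ := exists_unbalanced_ramsey_graph (m := 2 ^ a ^ 2) (s := 4 * a)
    (t := Y + 1) (q := 2 ^ (2 * a)) (by positivity) (by linarith)
  refine avoidsMono_three_of_graph A hA1 hA2 le_rfl ?_
  have : 2 ^ (4 * a) = Y * 2 ^ a := by
    rw [hY, ← pow_add]
    ring_nf
  rw [this]
  nlinarith

/-! ### The tower bound -/

theorem expTower_mono (m : ℕ) {x y : ℝ} (h : x ≤ y) : expTower m x ≤ expTower m y := by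
  induction m with
  | zero => exact h
  | succ m ih => exact Real.rpow_le_rpow_of_exponent_le (by norm_num) ih

/-- For `j ≤ a` the additive terms in `AvoidsMono.step` are small, so each step costs at most a
factor 4 in `l`. -/
theorem exists_avoidsMono_tower {a : ℕ} (ha : 8 ≤ a) (j : ℕ) (hj : j ≤ a) :
    ∃ N : ℕ, AvoidsMono (j + 3) (2 ^ (4 * a + 2 * j)) N ∧
      expTower (j + 1) (2 ^ a ^ 2) ≤ N := by
  induction j with
  | zero =>
    refine ⟨2 ^ 2 ^ a ^ 2, avoidsMono_three ha, ?_⟩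
    rw [expTower, expTower]
    exact_mod_cast le_refl ((2 : ℝ) ^ ((2 ^ a ^ 2 : ℕ) : ℝ))
  | succ j ih =>
    obtain ⟨N, hN, hle⟩ := ih (by omega)
    refine ⟨2 ^ N, (hN.step (by omega)).mono ?_, ?_⟩
    · have h1 : a < 2 ^ (4 * a + 2 * j) :=
        Nat.lt_two_pow_self.trans_le (Nat.pow_le_pow_right (by norm_num) (by omega))
      rw [show 4 * a + 2 * (j + 1) = (4 * a + 2 * j) + 2 by ring, pow_add 2 _ 2]
      omega
    · rw [expTower]
      calc (2 : ℝ) ^ expTower (j + 1) (2 ^ a ^ 2) ≤ (2 : ℝ) ^ (N : ℝ) :=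
            Real.rpow_le_rpow_of_exponent_le (by norm_num) hle
        _ = ((2 ^ N : ℕ) : ℝ) := by
            rw [Real.rpow_natCast]
            push_cast
            rfl

/-- With `x = log l ≤ 8 * a` and `log x ≤ x`, the exponent of 2 is at most `x ^ 2 / 64 ≤ a ^ 2`. -/
theorem rpow_logb_logb_le {l a : ℕ} (hlow : 4 ≤ l) (hup : l ≤ 2 ^ (8 * a)) :
    (l : ℝ) ^ ((1 / 64 : ℝ) * Real.logb 2 (Real.logb 2 (l : ℝ))) ≤ 2 ^ a ^ 2 := by
  have hl : (0 : ℝ) < l := by positivity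
  set x := Real.logb 2 (l : ℝ) with hx
  have hlx : (l : ℝ) = 2 ^ x := (Real.rpow_logb (by norm_num) (by norm_num) hl).symm
  have hx8 : x ≤ 8 * a := by
    rw [hx, Real.logb_le_iff_le_rpow (by norm_num) hl]
    exact_mod_cast hup
  have hx1 : 1 ≤ x := by
    rw [hx, Real.le_logb_iff_rpow_le (by norm_num) hl]
    have : (4 : ℝ) ≤ l := by exact_mod_cast hlow
    norm_num
    linarith
  have hlog : Real.logb 2 x ≤ x := by
    rw [Real.logb_le_iff_le_rpow (by norm_num) (by linarith)]
    have := one_add_mul_self_le_rpow_one_add (s := 1) (by norm_num) hx1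
    norm_num at this
    linarith
  rw [hlx, ← Real.rpow_mul (by norm_num), ← Real.rpow_natCast]
  refine Real.rpow_le_rpow_of_exponent_le (by norm_num) ?_
  push_cast
  nlinarith

theorem theorem3 (k : ℕ) (hk : 3 ≤ k) :
    ∃ c : ℝ, 0 < c ∧ ∃ l₀ : ℕ, ∀ l : ℕ, l₀ ≤ l →
      expTower (k - 2) ((l : ℝ) ^ (c * Real.logb 2 (Real.logb 2 (l : ℝ)))) ≤
        (ramseyNumber k ![l, l, l] : ℝ) := by
  -- The threshold gives `a ≥ k + 8` below, so `4 * a + 2 * (k - 3) ≤ 6 * a`, and rounding in `a`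
  -- still leaves `l ≤ 2 ^ (8 * a)`.
  refine ⟨1 / 64, by norm_num, 2 ^ (6 * (k + 8)), fun l hl => ?_⟩
  have hlpos : l ≠ 0 := by
    have := Nat.one_le_two_pow (n := 6 * (k + 8))
    omega
  set a := Nat.log 2 l / 6 with ha
  have hlog : 6 * (k + 8) ≤ Nat.log 2 l := Nat.le_log_of_pow_le (by norm_num) hl
  have hlow : 2 ^ (6 * a) ≤ l :=
    (Nat.pow_le_pow_right (by norm_num) (by omega)).trans (Nat.pow_log_le_self 2 hlpos)
  have hup : l ≤ 2 ^ (8 * a) :=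
    (Nat.lt_pow_succ_log_self (by norm_num) l).le.trans
      (Nat.pow_le_pow_right (by norm_num) (by omega))
  have h4 : 4 ≤ l := le_trans (Nat.pow_le_pow_right (n := 2) (i := 2) (by norm_num) (by omega)) hl
  obtain ⟨N, hN, hle⟩ := exists_avoidsMono_tower (a := a) (by omega) (k - 3) (by omega)
  rw [show k - 3 + 3 = k by omega] at hN
  rw [show k - 3 + 1 = k - 2 by omega] at hle
  have hN' : AvoidsMono k l N :=
    hN.mono ((Nat.pow_le_pow_right (by norm_num) (by omega)).trans hlow)
  calc _ ≤ expTower (k - 2) (2 ^ a ^ 2) :=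
        expTower_mono _ (rpow_logb_logb_le h4 hup)
    _ ≤ N := hle
    _ ≤ ramseyNumber k ![l, l, l] := by exact_mod_cast hN'.le_ramseyNumber
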